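/- Let $s,k,\ell$ be integers with $1\le \ell\le k$ and $s\ge 4\ell$, and let $n=sk+\ell$. Write $[n]=\{1,\dots,n\}$ and let $\binom{X}{k}$ denote the family of all $k$-element subsets of a set $X$. Let $\mathcal F_0,\mathcal F_1,\dots,\mathcal F_s\subset\binom{[n]}{k}$ be non-empty families that are cross-union, i.e. $A_0\cup A_1\cup\dots\cup A_s\ne[n]$ for every choice of $A_0\in\mathcal F_0,\dots,A_s\in\mathcal F_s$. Then $$\frac{|\mathcal F_0|+|\mathcal F_1|+\dots+|\mathcal F_s|}{s+1}\le\binom{n-1}{k}.$$ Furthermore, equality is attained only if $\mathcal F_0=\dots=\mathcal F_s=\binom{[n]\setminus\{i\}}{k}$ for some $i\in[n]$. -/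

import Mathlib

/-- The families `F 0, …, F s` of subsets of the `n`-element ground set `[n]` (modelled by `Fin n`)
are cross-union: the union of `A 0, …, A s` is different from `[n]` for every choice of
`A i ∈ F i`. -/
def CrossUnion {n s : ℕ} (F : Fin (s + 1) → Finset (Finset (Fin n))) : Prop :=
  ∀ A : Fin (s + 1) → Finset (Fin n), (∀ i, A i ∈ F i) →
    Finset.univ.biUnion A ≠ Finset.univ

/-! ### Spectral gap of the Johnson graph -/

section Poincare
open Finset
variable {α : Type*} [DecidableEq α]

/-! Suppose the sum of the `|F i|` is at least (s+1)·C(n-1,k), and let F_j be the smallest family.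
Let S be a collection of l-sets, each inside a member of F_j. For L in S, split the complement of L
into s ordered k-sets, one for each index i ≠ j. By cross-union, some cell must be missing from its
family. Averaging over L and over the partitions (`CrossUnion.density_le`) gives: density of S ≤ sum
over i ≠ j of (1 - density of F_i).

It remains to find an S denser than F_j by (k-l)/n, because then the densities of all families sum
to at most s - (k-l)/n = (s+1)(n-k)/n, the claimed bound. This is `exists_iterated_shadow`: while
the density lies between r/n and 1 - r/n at level r, taking the shadow gains at least 1/n, by the
spectral gap of the Johnson graph (`johnson_poincare`). The lower end of this range holds for F_j by
a cruder count from a single L (`CrossUnion.mul_choose_le_card`). At the upper end the family is cut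
down to the size of the complement of a star.

In the case of equality, each partition of the complement of an l-set has exactly one missing cell
or none, depending only on the l-set. Swapping elements between two cells then shows that the
missing families are one common star (`IsExactHitting.exists_star`). -/

theorem sum_erase_powersetCard (V : Finset α) (k : ℕ) (g : α → Finset α → ℝ) :
    ∑ x ∈ V, ∑ C ∈ powersetCard k (V.erase x), g x C =
      ∑ C ∈ powersetCard k V, ∑ x ∈ V \ C, g x C := by
  refine Finset.sum_comm' fun x C => ?_
  simp only [mem_powersetCard, mem_sdiff, subset_erase]
  tauto

theorem sum_powersetCard_succ_sum_mem (V : Finset α) (k : ℕ) (g : α → Finset α → ℝ) :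
    ∑ A ∈ powersetCard (k + 1) V, ∑ x ∈ A, g x A =
      ∑ C ∈ powersetCard k V, ∑ x ∈ V \ C, g x (insert x C) := by
  rw [Finset.sum_sigma', Finset.sum_sigma']
  refine Finset.sum_bij' (fun p _ => ⟨p.1.erase p.2, p.2⟩) (fun p _ => ⟨insert p.2 p.1, p.2⟩)
    ?_ ?_ ?_ ?_ ?_
  · rintro ⟨A, x⟩ h
    simp only [mem_sigma, mem_powersetCard, mem_sdiff] at h ⊢
    exact ⟨⟨(erase_subset _ _).trans h.1.1, by rw [card_erase_of_mem h.2, h.1.2]; rfl⟩,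
      h.1.1 h.2, notMem_erase _ _⟩
  · rintro ⟨C, x⟩ h
    simp only [mem_sigma, mem_powersetCard, mem_sdiff] at h ⊢
    exact ⟨⟨insert_subset h.2.1 h.1.1, by rw [card_insert_of_notMem h.2.2, h.1.2]⟩,
      mem_insert_self _ _⟩
  · rintro ⟨A, x⟩ h
    simp only [mem_sigma] at h
    simp [insert_erase h.2]
  · rintro ⟨C, x⟩ h
    simp only [mem_sigma, mem_sdiff] at h
    simp [erase_insert h.2.2]
  · rintro ⟨A, x⟩ h
    simp only [mem_sigma] at h
    simp [insert_erase h.2]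

theorem sum_powersetCard_succ_sum (V : Finset α) (k : ℕ) (h : α → ℝ) :
    ∑ A ∈ powersetCard (k + 1) V, ∑ x ∈ A, h x = ((#V - 1).choose k : ℝ) * ∑ x ∈ V, h x := by
  rw [sum_powersetCard_succ_sum_mem V k (fun x _ => h x),
    ← sum_erase_powersetCard V k (fun x _ => h x), mul_sum]
  refine sum_congr rfl fun x hx => ?_
  rw [sum_const, card_powersetCard, card_erase_of_mem hx, nsmul_eq_mul]

theorem sum_sum_sub_sq {ι : Type*} (S : Finset ι) (f : ι → ℝ) :
    ∑ x ∈ S, ∑ y ∈ S, (f x - f y) ^ 2 = 2 * (#S * ∑ x ∈ S, f x ^ 2 - (∑ x ∈ S, f x) ^ 2) := by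
  have : ∀ x y, (f x - f y) ^ 2 = f x ^ 2 + f y ^ 2 - 2 * (f x * f y) := fun x y => by ring
  simp only [this, sum_sub_distrib, sum_add_distrib, sum_const, nsmul_eq_mul, ← mul_sum, ← sum_mul]
  ring

/-- The Dirichlet form of the Johnson graph on the `(k + 1)`-subsets of `V`. -/
noncomputable def johnsonEnergy (V : Finset α) (k : ℕ) (f : Finset α → ℝ) : ℝ :=
  ∑ C ∈ powersetCard k V, ∑ x ∈ V \ C, ∑ y ∈ V \ C, (f (insert x C) - f (insert y C)) ^ 2

/-- Each term of the energy at a (k+1)-set D appears in the link of every z in D, hence k+1 times.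
This lets the Poincaré inequality pass from links to the whole by induction. -/
theorem sum_link_johnsonEnergy (V : Finset α) (k : ℕ) (f : Finset α → ℝ) :
    ∑ z ∈ V, johnsonEnergy (V.erase z) k (fun A => f (insert z A)) =
      (k + 1) * johnsonEnergy V (k + 1) f := by
  set G : Finset α → ℝ := fun C =>
    ∑ x ∈ V \ C, ∑ y ∈ V \ C, (f (insert x C) - f (insert y C)) ^ 2 with hG
  have h1 : ∀ z ∈ V, johnsonEnergy (V.erase z) k (fun A => f (insert z A)) =
      ∑ C ∈ powersetCard k (V.erase z), G (insert z C) := by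
    intro z hz
    refine sum_congr rfl fun C hC => ?_
    have : V.erase z \ C = V \ insert z C := by
      ext a; simp only [mem_sdiff, mem_erase, mem_insert]; tauto
    simp only [hG, this, fun x => Finset.insert_comm z x C]
  rw [sum_congr rfl h1, sum_erase_powersetCard V k (fun z C => G (insert z C)),
    ← sum_powersetCard_succ_sum_mem V k (fun _ A => G A), johnsonEnergy, mul_sum]
  refine sum_congr rfl fun A hA => ?_
  rw [sum_const, (mem_powersetCard.1 hA).2, nsmul_eq_mul]
  push_cast
  rfl

/-- Controls the link means, the part of f that the inductive hypothesis does not see. It comes from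
the nonnegativity of the sum of squares of M·f(A) - ∑_{x ∈ A} g(x), where g is the degree function
of f. -/
theorem sum_sq_degree_le (V : Finset α) (k : ℕ) (hk : k + 3 ≤ #V) (f : Finset α → ℝ)
    (hf : ∑ A ∈ powersetCard (k + 2) V, f A = 0) :
    ∑ z ∈ V, (∑ A ∈ powersetCard (k + 1) (V.erase z), f (insert z A)) ^ 2 ≤
      ((#V - 2).choose (k + 1) : ℝ) * ∑ A ∈ powersetCard (k + 2) V, f A ^ 2 := by
  set g : α → ℝ := fun z => ∑ A ∈ powersetCard (k + 1) (V.erase z), f (insert z A) with hg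
  set M : ℝ := ((#V - 2).choose (k + 1) : ℝ) with hM
  have hMpos : 0 < M := by
    rw [hM]; exact_mod_cast Nat.choose_pos (by omega)
  -- The degree map is adjoint to h ↦ (A ↦ ∑_{x ∈ A} h x).
  have hpair : ∀ h : α → ℝ, ∑ A ∈ powersetCard (k + 2) V, f A * ∑ x ∈ A, h x =
      ∑ x ∈ V, h x * g x := by
    intro h
    have := sum_powersetCard_succ_sum_mem V (k + 1) (fun x A => h x * f A)
    rw [← sum_erase_powersetCard V (k + 1) (fun x C => h x * f (insert x C))] at this
    simp only [hg, mul_sum]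
    rw [← this]
    exact sum_congr rfl fun A _ => sum_congr rfl fun x _ => mul_comm _ _
  have hg0 : ∑ x ∈ V, g x = 0 := by
    have := hpair (fun _ => 1)
    simp only [one_mul] at this
    rw [← this, sum_congr rfl (g := fun A => f A * ((k : ℝ) + 2)), ← sum_mul, hf, zero_mul]
    intro A hA
    rw [sum_const, (mem_powersetCard.1 hA).2, nsmul_eq_mul]; push_cast; ring
  have hsq : ∑ A ∈ powersetCard (k + 2) V, (∑ x ∈ A, g x) ^ 2 = M * ∑ x ∈ V, g x ^ 2 := by
    have h1 : ∀ A : Finset α, (∑ x ∈ A, g x) ^ 2 = ∑ x ∈ A, g x * ∑ y ∈ A, g y := by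
      intro A; rw [← sum_mul, sq]
    simp only [h1]
    rw [sum_powersetCard_succ_sum_mem V (k + 1) (fun x A => g x * ∑ y ∈ A, g y),
      ← sum_erase_powersetCard V (k + 1) (fun x C => g x * ∑ y ∈ insert x C, g y), mul_sum]
    refine sum_congr rfl fun x hx => ?_
    have h2 : ∀ C ∈ powersetCard (k + 1) (V.erase x), g x * ∑ y ∈ insert x C, g y =
        g x * g x + g x * ∑ y ∈ C, g y := by
      intro C hC
      have : x ∉ C := fun h => notMem_erase x V ((mem_powersetCard.1 hC).1 h)
      rw [sum_insert this]; ring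
    rw [sum_congr rfl h2, sum_add_distrib, sum_const, card_powersetCard, ← mul_sum,
      sum_powersetCard_succ_sum, card_erase_of_mem hx, nsmul_eq_mul]
    have h3 : ∑ y ∈ V.erase x, g y = - g x := by
      have := add_sum_erase V g hx
      linarith
    obtain ⟨m, hm⟩ : ∃ m, #V = m + 2 := ⟨#V - 2, by omega⟩
    have h4 : (m + 1).choose (k + 1) = m.choose k + m.choose (k + 1) := Nat.choose_succ_succ _ _
    rw [h3, hM, hm]
    simp only [Nat.add_sub_cancel, show m + 2 - 1 = m + 1 from rfl, h4]
    push_cast; ring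
  have hnn : 0 ≤ ∑ A ∈ powersetCard (k + 2) V, (M * f A - ∑ x ∈ A, g x) ^ 2 :=
    sum_nonneg fun _ _ => sq_nonneg _
  have hexp : ∑ A ∈ powersetCard (k + 2) V, (M * f A - ∑ x ∈ A, g x) ^ 2 =
      M * (M * ∑ A ∈ powersetCard (k + 2) V, f A ^ 2 - ∑ x ∈ V, g x ^ 2) := by
    have h1 : ∀ A : Finset α, (M * f A - ∑ x ∈ A, g x) ^ 2 =
        M ^ 2 * f A ^ 2 - 2 * M * (f A * ∑ x ∈ A, g x) + (∑ x ∈ A, g x) ^ 2 := fun A => by ring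
    simp only [h1, sum_sub_distrib, sum_add_distrib, ← mul_sum, hpair, hsq, ← sq]
    ring
  rw [hexp] at hnn
  linarith [nonneg_of_mul_nonneg_right hnn hMpos]

/-- The Poincaré inequality for the Johnson graph on the `(k + 1)`-subsets of `V`. -/
theorem johnson_poincare (k : ℕ) : ∀ (V : Finset α) (f : Finset α → ℝ),
    2 * (#V : ℝ) * ((#V).choose (k + 1) * ∑ A ∈ powersetCard (k + 1) V, f A ^ 2 -
      (∑ A ∈ powersetCard (k + 1) V, f A) ^ 2) ≤
    (#V).choose (k + 1) * johnsonEnergy V k f := by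
  induction k with
  | zero =>
    intro V f
    have h := sum_sum_sub_sq V (fun x => f {x})
    simp only [johnsonEnergy, zero_add, powersetCard_zero, sum_singleton, powersetCard_one,
      sum_map, Nat.choose_one_right, sdiff_empty, insert_empty_eq, Function.Embedding.coeFn_mk]
    rw [h]
    apply le_of_eq; ring
  | succ k ih =>
    intro V f
    have hE : 0 ≤ johnsonEnergy V (k + 1) f :=
      sum_nonneg fun _ _ => sum_nonneg fun _ _ => sum_nonneg fun _ _ => sq_nonneg _
    -- With at most k+2 points there is at most one (k+2)-set, so there is no variance to bound.
    rcases Nat.lt_trichotomy (#V) (k + 2) with hn | hn | hn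
    · rw [Nat.choose_eq_zero_of_lt hn]
      have : 0 ≤ 2 * (#V : ℝ) * (∑ A ∈ powersetCard (k + 1 + 1) V, f A) ^ 2 := by positivity
      simp only [Nat.cast_zero, zero_mul, zero_sub]
      linarith
    · have : powersetCard (k + 1 + 1) V = {V} := by
        rw [show k + 1 + 1 = #V from hn.symm, powersetCard_self]
      rw [this]
      simp only [sum_singleton, hn, show k + 1 + 1 = k + 2 from rfl, Nat.choose_self]
      simpa using hE
    · obtain ⟨m, hm⟩ : ∃ m, #V = m + 2 := ⟨#V - 2, by omega⟩
      set N : ℝ := ((#V).choose (k + 2) : ℝ) with hN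
      have hNpos : 0 < N := by rw [hN]; exact_mod_cast Nat.choose_pos (by omega)
      set c : ℝ := (∑ A ∈ powersetCard (k + 2) V, f A) / N with hc
      set f' : Finset α → ℝ := fun A => f A - c with hf'
      have hEf : johnsonEnergy V (k + 1) f = johnsonEnergy V (k + 1) f' := by
        simp [johnsonEnergy, hf']
      have hcN : c * N = ∑ A ∈ powersetCard (k + 2) V, f A := by
        rw [hc]; field_simp
      have hsum0 : ∑ A ∈ powersetCard (k + 2) V, f' A = 0 := by
        simp only [hf', sum_sub_distrib, sum_const, card_powersetCard, nsmul_eq_mul]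
        rw [← hN]; linarith
      set Q : ℝ := ∑ A ∈ powersetCard (k + 2) V, f' A ^ 2 with hQ
      have hvar : N * ∑ A ∈ powersetCard (k + 2) V, f A ^ 2 -
          (∑ A ∈ powersetCard (k + 2) V, f A) ^ 2 = N * Q := by
        have h1 : ∀ A, f' A ^ 2 = f A ^ 2 - 2 * c * f A + c ^ 2 := fun A => by
          simp only [hf']; ring
        simp only [hQ, h1, sum_sub_distrib, sum_add_distrib, ← mul_sum, sum_const,
          card_powersetCard, nsmul_eq_mul]
        rw [← hN, ← hcN]; ring
      have hdeg := sum_sq_degree_le V k (by omega) f' hsum0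
      rw [← hQ] at hdeg
      set N1 : ℝ := ((m + 1).choose (k + 1) : ℝ) with hN1
      have hN1pos : 0 < N1 := by rw [hN1]; exact_mod_cast Nat.choose_pos (by omega)
      have hlink : ∀ z ∈ V, 2 * ((m : ℝ) + 1) * (N1 *
          ∑ A ∈ powersetCard (k + 1) (V.erase z), f' (insert z A) ^ 2 -
          (∑ A ∈ powersetCard (k + 1) (V.erase z), f' (insert z A)) ^ 2) ≤
          N1 * johnsonEnergy (V.erase z) k (fun A => f' (insert z A)) := by
        intro z hz
        have := ih (V.erase z) (fun A => f' (insert z A))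
        rw [card_erase_of_mem hz, hm, show m + 2 - 1 = m + 1 from rfl, ← hN1] at this
        push_cast at this
        exact this
      have htot := sum_le_sum hlink
      rw [← mul_sum, ← mul_sum, sum_link_johnsonEnergy, sum_sub_distrib, ← mul_sum,
        sum_erase_powersetCard V (k + 1) (fun z A => f' (insert z A) ^ 2),
        ← sum_powersetCard_succ_sum_mem V (k + 1) (fun _ A => f' A ^ 2)] at htot
      have hQ2 : ∑ A ∈ powersetCard (k + 1 + 1) V, ∑ _x ∈ A, f' A ^ 2 = (k + 2) * Q := by
        rw [hQ, mul_sum]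
        refine sum_congr rfl fun A hA => ?_
        rw [sum_const, (mem_powersetCard.1 hA).2, nsmul_eq_mul]; push_cast; ring
      rw [hQ2] at htot
      rw [hm, show m + 2 - 2 = m from rfl] at hdeg
      have hchoose : (m.choose (k + 1) : ℝ) * (m + 1) = N1 * (m - k) := by
        have := Nat.choose_mul_succ_eq m (k + 1)
        have h2 : m + 1 - (k + 1) = m - k := by omega
        rw [h2] at this
        rw [hN1, ← Nat.cast_sub (by omega : k ≤ m)]
        exact_mod_cast this
      -- Summing `hlink` over z and inserting the degree bound leaves the coefficient (m+1)(k+2) -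
      -- (m-k) = (k+1)(m+2), which is where the gap |V| = m+2 comes from.
      have key : N1 * (k + 1) * (2 * ((m : ℝ) + 2) * Q) ≤
          N1 * (k + 1) * johnsonEnergy V (k + 1) f' := by
        have : (2 * ((m : ℝ) + 1)) * ∑ z ∈ V,
            (∑ A ∈ powersetCard (k + 1) (V.erase z), f' (insert z A)) ^ 2 ≤
            (2 * ((m : ℝ) + 1)) * (m.choose (k + 1) * Q) :=
          mul_le_mul_of_nonneg_left hdeg (by positivity)
        have h5 : (2 * ((m : ℝ) + 1)) * (m.choose (k + 1) * Q) = 2 * Q * (N1 * (m - k)) := by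
          rw [← hchoose]; ring
        nlinarith
      have key2 := le_of_mul_le_mul_left key (by positivity)
      change 2 * (#V : ℝ) * (N * ∑ A ∈ powersetCard (k + 2) V, f A ^ 2 -
          (∑ A ∈ powersetCard (k + 2) V, f A) ^ 2) ≤ N * johnsonEnergy V (k + 1) f
      rw [hvar, hEf]
      have : 2 * (#V : ℝ) * (N * Q) = N * (2 * ((m : ℝ) + 2) * Q) := by
        rw [hm]; push_cast; ring
      rw [this]
      exact mul_le_mul_of_nonneg_left key2 hNpos.le

end Poincare

/-! ### Shadows gain density 1/n per level -/

section Shadow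
open Finset
open scoped FinsetFamily
variable {α : Type*} [DecidableEq α] [Fintype α]

/-- If t of the m points satisfy p, the sum is 2t(m-t). For t ≥ 1 this is at most 2(m-1)(m-t), since
either t = m or t ≤ m-1. The bound is linear in t, so it can be summed over the shadow. -/
theorem sum_sum_indicator_sub_sq_le {ι : Type*} (S : Finset ι) (p : ι → Prop) [DecidablePred p] :
    ∑ x ∈ S, ∑ y ∈ S, ((if p x then (1 : ℝ) else 0) - if p y then 1 else 0) ^ 2 ≤
      if ∃ x ∈ S, p x then 2 * ((#S : ℝ) - 1) * (#S - #{x ∈ S | p x}) else 0 := by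
  rw [sum_sum_sub_sq]
  have h1 : ∀ x, (if p x then (1 : ℝ) else 0) ^ 2 = if p x then 1 else 0 := by
    intro x; split_ifs <;> simp
  simp only [h1, sum_boole]
  have hle : #{x ∈ S | p x} ≤ #S := card_filter_le _ _
  split_ifs with h
  · obtain ⟨x, hx, hpx⟩ := h
    have hpos : 1 ≤ #{x ∈ S | p x} := card_pos.2 ⟨x, by simp [hx, hpx]⟩
    rcases hle.eq_or_lt with h2 | h2
    · rw [h2]; apply le_of_eq; ring
    · have h3 : (#{x ∈ S | p x} : ℝ) + 1 ≤ #S := by exact_mod_cast h2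
      nlinarith
  · have : #{x ∈ S | p x} = 0 := by
      rw [card_eq_zero, filter_eq_empty_iff]
      exact fun x hx hpx => h ⟨x, hx, hpx⟩
    simp [this]

/-- A family of `(k + 1)`-sets whose density is at least that of a star and at most that of the
complement of a star has a shadow of density larger by at least `1 / n`. -/
theorem card_shadow_lower_bound (k : ℕ) (hk : k + 1 < Fintype.card α) (F : Finset (Finset α))
    (hF : F ⊆ powersetCard (k + 1) univ)
    (h1 : ((k : ℝ) + 1) * (Fintype.card α).choose (k + 1) ≤ Fintype.card α * #F)
    (h2 : (Fintype.card α : ℝ) * #F ≤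
      (Fintype.card α - (k + 1)) * (Fintype.card α).choose (k + 1)) :
    (#F : ℝ) / (Fintype.card α).choose (k + 1) + 1 / Fintype.card α ≤
      #(∂ F) / (Fintype.card α).choose k := by
  set n := Fintype.card α with hn
  have hsized : (F : Set (Finset α)).Sized (k + 1) := fun A hA => (mem_powersetCard.1 (hF hA)).2
  have hshadow : ∂ F ⊆ powersetCard k univ := fun A hA =>
    mem_powersetCard.2 ⟨subset_univ _, hsized.shadow hA⟩
  set f : Finset α → ℝ := fun A => if A ∈ F then 1 else 0 with hf
  have hsumf : ∑ A ∈ powersetCard (k + 1) univ, f A = #F := by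
    rw [hf, sum_boole, filter_mem_eq_inter, inter_eq_right.2 hF]
  have hsumf2 : ∑ A ∈ powersetCard (k + 1) univ, f A ^ 2 = #F := by
    rw [← hsumf]
    refine sum_congr rfl fun A _ => ?_
    simp only [hf]; split_ifs <;> simp
  have hpoin := johnson_poincare k univ f
  rw [hsumf, hsumf2, card_univ, ← hn] at hpoin
  have hcard : ∀ C ∈ powersetCard k (univ : Finset α), (#(univ \ C) : ℝ) = n - k := by
    intro C hC
    rw [← compl_eq_univ_sdiff, card_compl, (mem_powersetCard.1 hC).2, Nat.cast_sub (by omega)]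
  have hlocal : ∀ C ∈ powersetCard k (univ : Finset α),
      ∑ x ∈ univ \ C, ∑ y ∈ univ \ C, (f (insert x C) - f (insert y C)) ^ 2 ≤
      2 * ((n : ℝ) - k - 1) * ((if C ∈ ∂ F then (n : ℝ) - k else 0) -
        ∑ x ∈ univ \ C, f (insert x C)) := by
    intro C hC
    have h := sum_sum_indicator_sub_sq_le (univ \ C) (fun x => insert x C ∈ F)
    have hmem : (∃ x ∈ univ \ C, insert x C ∈ F) ↔ C ∈ ∂ F := by
      rw [mem_shadow_iff_insert_mem]; simp only [mem_sdiff, mem_univ, true_and]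
    refine h.trans ?_
    simp only [hmem, hf, sum_boole, hcard C hC]
    split_ifs with hCF
    · exact le_of_eq (by ring)
    · have : #{x ∈ univ \ C | insert x C ∈ F} = 0 := by
        rw [card_eq_zero, filter_eq_empty_iff]
        exact fun x hx hpx => hCF (hmem.1 ⟨x, hx, hpx⟩)
      rw [this, Nat.cast_zero, sub_zero, mul_zero]
  have hen : johnsonEnergy univ k f ≤
      2 * ((n : ℝ) - k - 1) * ((n - k) * #(∂ F) - (k + 1) * #F) := by
    refine (sum_le_sum hlocal).trans (le_of_eq ?_)
    rw [← mul_sum, sum_sub_distrib, ← sum_powersetCard_succ_sum_mem univ k (fun _ A => f A)]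
    congr 2
    · rw [← sum_filter, filter_mem_eq_inter, inter_eq_right.2 hshadow, sum_const, nsmul_eq_mul]
      ring
    · rw [← hsumf, mul_sum]
      refine sum_congr rfl fun A hA => ?_
      rw [sum_const, (mem_powersetCard.1 hA).2, nsmul_eq_mul]; push_cast; ring
  set N : ℝ := (n.choose (k + 1) : ℝ) with hN
  set N' : ℝ := (n.choose k : ℝ) with hN'
  have hNpos : 0 < N := by rw [hN]; exact_mod_cast Nat.choose_pos (by omega)
  have hN'pos : 0 < N' := by rw [hN']; exact_mod_cast Nat.choose_pos (by omega)
  have hrel : N' * (n - k) = N * (k + 1) := by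
    have := Nat.choose_succ_right_eq n k
    rw [hN, hN', ← Nat.cast_sub (by omega : k ≤ n)]
    exact_mod_cast this.symm
  have hkn : (k : ℝ) + 1 < n := by exact_mod_cast hk
  set p : ℝ := #F / N with hp
  set q : ℝ := #(∂ F) / N' with hq
  have hFp : (#F : ℝ) = p * N := (div_mul_cancel₀ _ hNpos.ne').symm
  have hFq : (#(∂ F) : ℝ) = q * N' := (div_mul_cancel₀ _ hN'pos.ne').symm
  have hnpos : (0 : ℝ) < n := by exact_mod_cast (by omega : 0 < n)
  rw [hFp] at h1 h2
  have hp1 : (k : ℝ) + 1 ≤ n * p := by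
    refine le_of_mul_le_mul_right (a := N) ?_ hNpos; linarith
  have hp2 : (n : ℝ) * p ≤ n - (k + 1) := by
    refine le_of_mul_le_mul_right (a := N) ?_ hNpos; linarith
  have hmain : n * (N * N) * (p * (1 - p)) ≤
      (n - k - 1) * (k + 1) * (N * N) * (q - p) := by
    have h3 := hpoin.trans (mul_le_mul_of_nonneg_left hen hNpos.le)
    rw [hFp, hFq] at h3
    have h4 : (n - k) * (q * N') = q * (N * (k + 1)) := by rw [← hrel]; ring
    rw [h4] at h3
    nlinarith
  have hmain2 : n * (p * (1 - p)) ≤ (n - k - 1) * (k + 1) * (q - p) := by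
    refine le_of_mul_le_mul_right (a := N * N) ?_ (by positivity); linarith
  -- Expand (np - (k+1))(n - (k+1) - np) ≥ 0, valid because p lies between the two star densities.
  have hquad : ((k : ℝ) + 1) * (n - k - 1) ≤ n * (n * (p * (1 - p))) := by
    nlinarith [mul_nonneg (sub_nonneg.2 hp1) (sub_nonneg.2 hp2)]
  have hfin : ((k : ℝ) + 1) * (n - k - 1) * 1 ≤ ((k : ℝ) + 1) * (n - k - 1) * (n * (q - p)) := by
    have := mul_le_mul_of_nonneg_left hmain2 hnpos.le
    linarith
  have hpos : 0 < ((k : ℝ) + 1) * (n - k - 1) := mul_pos (by positivity) (by linarith)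
  have := le_of_mul_le_mul_left hfin hpos
  have : 1 / (n : ℝ) ≤ q - p := by
    rw [div_le_iff₀ hnpos]; linarith
  linarith

theorem choose_pred_mul (n k : ℕ) (hn : 1 ≤ n) (hk : k ≤ n) :
    (n : ℝ) * ((n - 1).choose k : ℝ) = (n - k) * n.choose k := by
  obtain ⟨m, rfl⟩ : ∃ m, n = m + 1 := ⟨n - 1, by omega⟩
  have := Nat.choose_mul_succ_eq m k
  rw [← Nat.cast_sub hk]
  rw [Nat.add_sub_cancel]
  have h : (m + 1) * m.choose k = (m + 1 - k) * (m + 1).choose k := by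
    rw [mul_comm, this, mul_comm]
  exact_mod_cast h

/-- A family `F` of `(l + d)`-sets whose density is between that of a star and that of the
complement of a star contains, among the `l`-subsets of its members, a family of density larger by
at least `d / n`. -/
theorem exists_iterated_shadow (l : ℕ) (hl : 1 ≤ l) (d : ℕ) :
    2 * (l + d) ≤ Fintype.card α → ∀ F ⊆ powersetCard (l + d) (univ : Finset α),
    ((l : ℝ) + d) * (Fintype.card α).choose (l + d) ≤ Fintype.card α * #F →
    (Fintype.card α : ℝ) * #F ≤
      (Fintype.card α - (l + d)) * (Fintype.card α).choose (l + d) →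
    ∃ S ⊆ powersetCard l (univ : Finset α), (∀ L ∈ S, ∃ A ∈ F, L ⊆ A) ∧
      (#F : ℝ) / (Fintype.card α).choose (l + d) + d / Fintype.card α ≤
        #S / (Fintype.card α).choose l := by
  induction d with
  | zero =>
    intro _ F hF _ _
    exact ⟨F, hF, fun L hL => ⟨L, hL, Subset.rfl⟩, by simp⟩
  | succ d ih =>
    intro hcard F hF h1 h2
    set n := Fintype.card α with hn
    have hnpos : (0 : ℝ) < n := by exact_mod_cast (by omega : 0 < n)
    change _ * ((n.choose (l + d + 1) : ℕ) : ℝ) ≤ _ at h1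
    change _ ≤ _ * ((n.choose (l + d + 1) : ℕ) : ℝ) at h2
    rw [Nat.cast_succ, ← add_assoc] at h1 h2
    have hstep := card_shadow_lower_bound (l + d) (by omega) F hF
      (by rw [Nat.cast_add]; exact h1) (by rw [Nat.cast_add]; exact h2)
    rw [← hn] at hstep
    have hNpos : (0 : ℝ) < n.choose (l + d) := by exact_mod_cast Nat.choose_pos (by omega)
    have hN1pos : (0 : ℝ) < n.choose (l + d + 1) := by exact_mod_cast Nat.choose_pos (by omega)
    have hsized : (F : Set (Finset α)).Sized (l + d + 1) :=
      fun A hA => (mem_powersetCard.1 (hF hA)).2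
    have hshadow : ∂ F ⊆ powersetCard (l + d) univ := fun A hA =>
      mem_powersetCard.2 ⟨subset_univ _, hsized.shadow hA⟩
    have hstar := choose_pred_mul n (l + d) (by omega) (by omega)
    have hlow : ((l : ℝ) + d + 1) / n ≤ #F / n.choose (l + d + 1) := by
      rw [div_le_div_iff₀ hnpos hN1pos]
      linarith
    have hup : (#F : ℝ) / n.choose (l + d + 1) ≤ (n - (l + d + 1)) / n := by
      rw [div_le_div_iff₀ hN1pos hnpos]
      linarith
    have hcardR : 2 * ((l : ℝ) + d + 1) ≤ n := by exact_mod_cast hcard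
    -- If the shadow is too dense for the next step, it is trimmed to density 1 - (l+d)/n. Nothing
    -- is lost, since F has density at most 1 - (l+d+1)/n.
    obtain ⟨G, hGF, hG1, hG2⟩ : ∃ G ⊆ ∂ F,
        (#F : ℝ) / n.choose (l + d + 1) + 1 / n ≤ #G / n.choose (l + d) ∧
        (n : ℝ) * #G ≤ (n - (l + d)) * n.choose (l + d) := by
      rcases le_total ((n : ℝ) * #(∂ F)) ((n - (l + d)) * n.choose (l + d)) with h | h
      · exact ⟨∂ F, Subset.rfl, hstep, h⟩
      · push_cast at hstar
        have h3 : (n - 1).choose (l + d) ≤ #(∂ F) := by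
          have : (n : ℝ) * ((n - 1).choose (l + d) : ℝ) ≤ n * #(∂ F) := by linarith
          exact_mod_cast le_of_mul_le_mul_left this hnpos
        obtain ⟨G, hG, hGc⟩ := exists_subset_card_eq h3
        refine ⟨G, hG, ?_, by rw [hGc, hstar]⟩
        have : (#G : ℝ) / n.choose (l + d) = (n - (l + d)) / n := by
          rw [hGc, div_eq_div_iff hNpos.ne' hnpos.ne']; linarith
        rw [this]
        calc _ ≤ ((n : ℝ) - (l + d + 1)) / n + 1 / n := by gcongr
          _ = _ := by rw [← add_div]; ring_nf
    obtain ⟨S, hS, hSG, hSc⟩ := ih (by omega) G (hGF.trans hshadow)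
      (by
        have h4 : ((l : ℝ) + d) / n ≤ #G / n.choose (l + d) := by
          refine le_trans ?_ (hlow.trans ((le_add_of_nonneg_right (by positivity)).trans hG1))
          exact div_le_div_of_nonneg_right (by linarith) hnpos.le
        rw [div_le_div_iff₀ hnpos hNpos] at h4
        linarith) hG2
    refine ⟨S, hS, fun L hL => ?_, ?_⟩
    · obtain ⟨A, hA, hLA⟩ := hSG L hL
      obtain ⟨B, hB, hAB⟩ := exists_subset_of_mem_shadow (hGF hA)
      exact ⟨B, hB, hLA.trans hAB⟩
    · have : ((d + 1 : ℕ) : ℝ) / n = 1 / n + d / n := by push_cast; ring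
      rw [this]
      change (#F : ℝ) / n.choose (l + d + 1) + _ ≤ _
      linarith

end Shadow

/-! ### Averaging over ordered partitions into k-sets -/

section Averaging
open Finset
variable {α : Type*} [DecidableEq α] {ι : Type*} {k : ℕ}

/-- The `i`-th part of the ordered partition of `V` into `k`-sets given by `e`. -/
def block {V : Finset α} (e : ι × Fin k ≃ V) (i : ι) : Finset α :=
  univ.image fun t => (e (i, t) : α)

theorem mem_block {V : Finset α} (e : ι × Fin k ≃ V) (i : ι) (a : α) :
    a ∈ block e i ↔ ∃ t, (e (i, t) : α) = a := by
  simp [block]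

theorem block_mem_powersetCard {V : Finset α} (e : ι × Fin k ≃ V) (i : ι) :
    block e i ∈ powersetCard k V := by
  refine mem_powersetCard.2 ⟨fun a ha => ?_, ?_⟩
  · obtain ⟨t, rfl⟩ := (mem_block e i a).1 ha
    exact (e (i, t)).2
  · rw [block, card_image_of_injective, card_univ, Fintype.card_fin]
    intro t t' h
    simpa using e.injective (Subtype.ext h)

theorem exists_mem_block {V : Finset α} (e : ι × Fin k ≃ V) {a : α} (ha : a ∈ V) :
    ∃ i, a ∈ block e i :=
  ⟨(e.symm ⟨a, ha⟩).1, (mem_block e _ a).2 ⟨(e.symm ⟨a, ha⟩).2, by simp⟩⟩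

theorem disjoint_block {V : Finset α} (e : ι × Fin k ≃ V) {i h : ι} (hih : i ≠ h) :
    Disjoint (block e i) (block e h) := by
  rw [disjoint_left]
  intro a ha ha'
  obtain ⟨t, ht⟩ := (mem_block e i a).1 ha
  obtain ⟨t', ht'⟩ := (mem_block e h a).1 ha'
  have := e.injective (Subtype.ext (ht.trans ht'.symm))
  simp only [Prod.mk.injEq] at this
  exact hih this.1

theorem block_trans {V : Finset α} (e : ι × Fin k ≃ V) (τ : Equiv.Perm V) (i : ι) (a : V) :
    (a : α) ∈ block (e.trans τ) i ↔ (τ.symm a : α) ∈ block e i := by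
  rw [mem_block, mem_block]
  simp only [Equiv.trans_apply, Subtype.coe_inj]
  exact exists_congr fun t => by rw [Equiv.eq_symm_apply]

variable [Fintype ι] [DecidableEq ι]

theorem exists_block_eq_and_block_eq {V : Finset α} (hV : #V = Fintype.card ι * k) {i h : ι}
    (hih : i ≠ h) {A B : Finset α} (hA : A ∈ powersetCard k V) (hB : B ∈ powersetCard k V)
    (hAB : Disjoint A B) : ∃ e : ι × Fin k ≃ V, block e i = A ∧ block e h = B := by
  rw [mem_powersetCard] at hA hB
  let a := A.equivFinOfCardEq hA.2
  let b := B.equivFinOfCardEq hB.2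
  let f : ι × Fin k → α := fun q => if q.1 = i then a.symm q.2 else b.symm q.2
  have hmaps : Set.MapsTo f {q | q.1 = i ∨ q.1 = h} (V : Set α) := by
    rintro ⟨j, t⟩ _
    by_cases hj : j = i
    · simpa [f, hj] using hA.1 (a.symm t).2
    · simpa [f, hj] using hB.1 (b.symm t).2
  have hne : ∀ t t', (a.symm t : α) ≠ b.symm t' := fun t t' hh =>
    disjoint_left.1 hAB (a.symm t).2 (hh ▸ (b.symm t').2)
  have hinj : Set.InjOn f {q | q.1 = i ∨ q.1 = h} := by
    rintro ⟨j, t⟩ hj ⟨j', t'⟩ hj' hh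
    rcases hj with hj | hj <;> rcases hj' with hj' | hj' <;> simp only at hj hj' <;> subst hj <;>
      subst hj'
    · simpa [f, Subtype.coe_inj] using hh
    · exact absurd (by simpa [f, hih.symm] using hh) (hne t t')
    · exact absurd (by simpa [f, hih.symm] using hh.symm) (hne t' t)
    · simpa [f, hih.symm, Subtype.coe_inj] using hh
  obtain ⟨e, he⟩ := hmaps.exists_equiv_extend_of_card_eq
    (by rw [hV, Fintype.card_prod, Fintype.card_fin]) hinj
  refine ⟨e, ?_, ?_⟩
  · ext x
    rw [mem_block]
    constructor
    · rintro ⟨t, rfl⟩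
      rw [he (i, t) (Or.inl rfl)]
      simp [f]
    · intro hx
      refine ⟨a ⟨x, hx⟩, ?_⟩
      rw [he (i, _) (Or.inl rfl)]
      simp [f]
  · ext x
    rw [mem_block]
    constructor
    · rintro ⟨t, rfl⟩
      rw [he (h, t) (Or.inr rfl)]
      simp [f, hih.symm]
    · intro hx
      refine ⟨b ⟨x, hx⟩, ?_⟩
      rw [he (h, _) (Or.inr rfl)]
      simp [f, hih.symm]

omit [DecidableEq ι] in
theorem exists_block_eq {V : Finset α} (hV : #V = Fintype.card ι * k) (i : ι)
    {A : Finset α} (hA : A ∈ powersetCard k V) : ∃ e : ι × Fin k ≃ V, block e i = A := by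
  rw [mem_powersetCard] at hA
  let a := A.equivFinOfCardEq hA.2
  let f : ι × Fin k → α := fun q => a.symm q.2
  have hmaps : Set.MapsTo f {q | q.1 = i} (V : Set α) := fun q _ => hA.1 (a.symm q.2).2
  have hinj : Set.InjOn f {q | q.1 = i} := by
    rintro ⟨j, t⟩ hj ⟨j', t'⟩ hj' hh
    simp only [Set.mem_ofPred_eq] at hj hj'
    subst hj; subst hj'
    simpa [f, Subtype.coe_inj] using hh
  obtain ⟨e, he⟩ := hmaps.exists_equiv_extend_of_card_eq
    (by rw [hV, Fintype.card_prod, Fintype.card_fin]) hinj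
  refine ⟨e, ?_⟩
  ext x
  rw [mem_block]
  constructor
  · rintro ⟨t, rfl⟩
    rw [he (i, t) rfl]
    simp [f]
  · intro hx
    refine ⟨a ⟨x, hx⟩, ?_⟩
    rw [he (i, _) rfl]
    simp [f]

/-- A permutation of V carrying A to B maps one fibre injectively into the other. Applying this in
both directions gives equidistribution. -/
theorem card_block_eq_const {V : Finset α} (hV : #V = Fintype.card ι * k) (i : ι)
    {A B : Finset α} (hA : A ∈ powersetCard k V) (hB : B ∈ powersetCard k V) :
    #{e : ι × Fin k ≃ V | block e i = A} ≤ #{e : ι × Fin k ≃ V | block e i = B} := by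
  obtain ⟨e₁, h₁⟩ := exists_block_eq hV i hA
  obtain ⟨e₂, h₂⟩ := exists_block_eq hV i hB
  let τ : Equiv.Perm V := e₁.symm.trans e₂
  refine card_le_card_of_injOn (fun e => e.trans τ) ?_ ?_
  · intro e he
    simp only [coe_filter, mem_univ, true_and, Set.mem_ofPred_eq] at he ⊢
    ext x
    by_cases hx : x ∈ V
    · rw [block_trans e τ i ⟨x, hx⟩, he, ← h₁, ← h₂, mem_block, mem_block]
      simp only [τ, Equiv.symm_trans_apply, Equiv.symm_symm, Subtype.coe_inj]
      refine exists_congr fun t => ?_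
      rw [e₁.apply_eq_iff_eq, Equiv.eq_symm_apply, Subtype.ext_iff]
    · exact iff_of_false (fun h => hx ((mem_powersetCard.1 (block_mem_powersetCard _ i)).1 h))
        (fun h => hx ((mem_powersetCard.1 hB).1 h))
  · intro e _ e' _ h
    ext q
    have := congrArg (fun g : ι × Fin k ≃ V => g q) h
    simpa [Subtype.coe_inj] using this

/-- Averaging over ordered partitions: each part is equidistributed over the `k`-subsets. -/
theorem sum_block_mul_choose {V : Finset α} (hV : #V = Fintype.card ι * k) (i : ι)
    (g : Finset α → ℝ) :
    (∑ e : ι × Fin k ≃ V, g (block e i)) * (#V).choose k =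
      Fintype.card (ι × Fin k ≃ V) * ∑ A ∈ powersetCard k V, g A := by
  have hfib : ∀ g : Finset α → ℝ, ∑ e : ι × Fin k ≃ V, g (block e i) =
      ∑ A ∈ powersetCard k V, (#{e : ι × Fin k ≃ V | block e i = A} : ℝ) * g A := by
    intro g
    rw [← sum_fiberwise_of_maps_to (fun e _ => block_mem_powersetCard e i)]
    refine sum_congr rfl fun A _ => ?_
    rw [sum_congr rfl (g := fun _ => g A), sum_const, nsmul_eq_mul]
    intro e he
    rw [(mem_filter.1 he).2]
  rcases (powersetCard k V).eq_empty_or_nonempty with h0 | ⟨A₀, hA₀⟩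
  · rw [hfib, h0]; simp
  · set c := #{e : ι × Fin k ≃ V | block e i = A₀} with hc
    have hconst : ∀ A ∈ powersetCard k V, #{e : ι × Fin k ≃ V | block e i = A} = c := fun A hA =>
      le_antisymm (card_block_eq_const hV i hA hA₀) (card_block_eq_const hV i hA₀ hA)
    have h1 : ∀ g : Finset α → ℝ, ∑ e : ι × Fin k ≃ V, g (block e i) =
        c * ∑ A ∈ powersetCard k V, g A := by
      intro g
      rw [hfib, mul_sum]
      exact sum_congr rfl fun A hA => by rw [hconst A hA]
    have h2 := h1 (fun _ => 1)
    simp only [sum_const, nsmul_eq_mul, mul_one, card_univ, card_powersetCard] at h2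
    rw [h1, h2]; ring

/-- If every ordered partition of `V` into `k`-sets has weight at least `b`, then the total weight
of the `k`-subsets of `V` is at least `b` times their number; in the case of equality all ordered
partitions have weight `b`. -/
theorem choose_mul_le_sum_sum {V : Finset α} (hV : #V = Fintype.card ι * k)
    (g : ι → Finset α → ℝ) (b : ℝ) (hb : ∀ e : ι × Fin k ≃ V, b ≤ ∑ i, g i (block e i)) :
    (#V).choose k * b ≤ ∑ i, ∑ A ∈ powersetCard k V, g i A ∧
    (∑ i, ∑ A ∈ powersetCard k V, g i A ≤ (#V).choose k * b → 0 < (#V).choose k →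
      ∀ e : ι × Fin k ≃ V, ∑ i, g i (block e i) = b) := by
  have hEq : (∑ e : ι × Fin k ≃ V, ∑ i, g i (block e i)) * (#V).choose k =
      Fintype.card (ι × Fin k ≃ V) * ∑ i, ∑ A ∈ powersetCard k V, g i A := by
    rw [sum_comm, sum_mul, mul_sum]
    exact sum_congr rfl fun i _ => sum_block_mul_choose hV i (g i)
  have hne : Nonempty (ι × Fin k ≃ V) := by
    rw [← Fintype.card_eq, Fintype.card_prod, Fintype.card_fin, Fintype.card_coe, hV]
  have hpos : (0 : ℝ) < Fintype.card (ι × Fin k ≃ V) := by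
    exact_mod_cast Fintype.card_pos
  have hsum : Fintype.card (ι × Fin k ≃ V) * b ≤
      ∑ e : ι × Fin k ≃ V, ∑ i, g i (block e i) := by
    have := sum_le_sum fun e (_ : e ∈ (univ : Finset (ι × Fin k ≃ V))) => hb e
    simpa using this
  refine ⟨?_, fun hle hch e => ?_⟩
  · refine le_of_mul_le_mul_left ?_ hpos
    rw [← hEq]
    have := mul_le_mul_of_nonneg_right hsum (Nat.cast_nonneg (α := ℝ) ((#V).choose k))
    linarith
  · have hchpos : (0 : ℝ) < (#V).choose k := by exact_mod_cast hch
    have h1 : ∑ e : ι × Fin k ≃ V, ∑ i, g i (block e i) ≤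
        Fintype.card (ι × Fin k ≃ V) * b := by
      refine le_of_mul_le_mul_right ?_ hchpos
      rw [hEq]
      have := mul_le_mul_of_nonneg_left hle hpos.le
      linarith
    have h2 : ∑ e : ι × Fin k ≃ V, b = ∑ e : ι × Fin k ≃ V, ∑ i, g i (block e i) := by
      rw [sum_const, card_univ, nsmul_eq_mul]
      exact le_antisymm hsum h1
    exact ((sum_eq_sum_iff_of_le fun e _ => hb e).1 h2 e (mem_univ e)).symm

theorem sum_compl_powersetCard [Fintype α] (l : ℕ) (g : Finset α → ℝ) :
    ∑ L ∈ powersetCard l (univ : Finset α), ∑ A ∈ powersetCard k Lᶜ, g A =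
      (Fintype.card α - k).choose l * ∑ A ∈ powersetCard k univ, g A := by
  have : ∑ L ∈ powersetCard l (univ : Finset α), ∑ A ∈ powersetCard k Lᶜ, g A =
      ∑ A ∈ powersetCard k univ, ∑ L ∈ powersetCard l Aᶜ, g A := by
    refine sum_comm' fun L A => ?_
    simp only [mem_powersetCard, subset_univ, true_and, subset_compl_comm (s := L)]
    tauto
  rw [this, mul_sum]
  refine sum_congr rfl fun A hA => ?_
  rw [sum_const, card_powersetCard, card_compl, (mem_powersetCard.1 hA).2, nsmul_eq_mul]

/-- If for every `L` in a family `S` of `l`-sets each ordered partition of the complement of `L` into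
`k`-sets has weight at least `1`, then the total weight is bounded below by the size of `S`; in the
case of equality, all ordered partitions of complements of `l`-sets have weight `1` or `0`
according to whether the `l`-set is in `S`. -/
theorem card_mul_choose_le_sum [Fintype α] (l : ℕ)
    (hn : Fintype.card α = Fintype.card ι * k + l) (hι : 0 < Fintype.card ι)
    (g : ι → Finset α → ℝ) (hg : ∀ i A, 0 ≤ g i A)
    (S : Finset (Finset α)) (hS : S ⊆ powersetCard l univ)
    (hb : ∀ L ∈ S, ∀ e : ι × Fin k ≃ (Lᶜ : Finset α), 1 ≤ ∑ i, g i (block e i)) :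
    (#S : ℝ) * (Fintype.card α - l).choose k ≤
      (Fintype.card α - k).choose l * ∑ i, ∑ A ∈ powersetCard k univ, g i A ∧
    ((Fintype.card α - k).choose l * ∑ i, ∑ A ∈ powersetCard k univ, g i A ≤
      (#S : ℝ) * (Fintype.card α - l).choose k →
      ∀ L ∈ powersetCard l univ, ∀ e : ι × Fin k ≃ (Lᶜ : Finset α),
        ∑ i, g i (block e i) = if L ∈ S then 1 else 0) := by
  have hcard : ∀ L ∈ powersetCard l (univ : Finset α), #Lᶜ = Fintype.card α - l := fun L hL => by
    rw [card_compl, (mem_powersetCard.1 hL).2]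
  have hcard' : ∀ L ∈ powersetCard l (univ : Finset α), #Lᶜ = Fintype.card ι * k := fun L hL => by
    rw [hcard L hL, hn, Nat.add_sub_cancel]
  have hbL : ∀ L ∈ powersetCard l (univ : Finset α), ∀ e : ι × Fin k ≃ (Lᶜ : Finset α),
      (if L ∈ S then (1 : ℝ) else 0) ≤ ∑ i, g i (block e i) := by
    intro L hL e
    split_ifs with h
    · exact hb L h e
    · exact sum_nonneg fun i _ => hg i _
  have hL := fun L hL => choose_mul_le_sum_sum (hcard' L hL) g _ (hbL L hL)
  have hleft : ∑ L ∈ powersetCard l (univ : Finset α),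
      ((#Lᶜ).choose k : ℝ) * (if L ∈ S then (1 : ℝ) else 0) =
      (#S : ℝ) * (Fintype.card α - l).choose k := by
    rw [sum_congr rfl (g := fun L => if L ∈ S then ((Fintype.card α - l).choose k : ℝ) else 0),
      ← sum_filter, filter_mem_eq_inter, inter_eq_right.2 hS, sum_const, nsmul_eq_mul]
    intro L hL
    rw [hcard L hL]; simp
  have hright : ∑ L ∈ powersetCard l (univ : Finset α), ∑ i, ∑ A ∈ powersetCard k Lᶜ, g i A =
      (Fintype.card α - k).choose l * ∑ i, ∑ A ∈ powersetCard k univ, g i A := by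
    rw [sum_comm, mul_sum]
    exact sum_congr rfl fun i _ => sum_compl_powersetCard l (g i)
  rw [← hleft, ← hright]
  refine ⟨sum_le_sum fun L h => (hL L h).1, fun hle L h => (hL L h).2 ?_ ?_⟩
  · have heq := le_antisymm (sum_le_sum fun L h => (hL L h).1) hle
    exact ((sum_eq_sum_iff_of_le fun L h => (hL L h).1).1 heq L h).ge
  · rw [hcard' L h]
    exact Nat.choose_pos (Nat.le_mul_of_pos_left k hι)

end Averaging

/-! ### Equality case: exact hitting forces a star -/

section Stars
open Finset
variable {α : Type*} [DecidableEq α] [Fintype α] {ι : Type*} [Fintype ι] [DecidableEq ι]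

/-- The ordered partitions of complements of `l`-sets contain one member of the families `N i` if
the `l`-set is in `S`, and none otherwise. -/
def IsExactHitting (k l : ℕ) (N : ι → Finset (Finset α)) (S : Finset (Finset α)) : Prop :=
  ∀ L ∈ powersetCard l (univ : Finset α), ∀ e : ι × Fin k ≃ (Lᶜ : Finset α),
    ∑ i, (if block e i ∈ N i then (1 : ℝ) else 0) = if L ∈ S then 1 else 0

variable {k l : ℕ} {N : ι → Finset (Finset α)} {S : Finset (Finset α)}

omit [DecidableEq ι] in
theorem card_compl_of_mem_powersetCard (hn : Fintype.card α = Fintype.card ι * k + l)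
    {L : Finset α} (hL : L ∈ powersetCard l (univ : Finset α)) : #Lᶜ = Fintype.card ι * k := by
  rw [card_compl, (mem_powersetCard.1 hL).2, hn, Nat.add_sub_cancel]

theorem exists_partition_of_disjoint (hn : Fintype.card α = Fintype.card ι * k + l)
    {i h : ι} (hih : i ≠ h) {A B : Finset α} (hA : #A = k) (hB : #B = k) (hAB : Disjoint A B) :
    ∃ L ∈ powersetCard l (univ : Finset α), ∃ e : ι × Fin k ≃ (Lᶜ : Finset α),
      block e i = A ∧ block e h = B := by
  have h2 : 2 ≤ Fintype.card ι := by
    have := card_le_univ ({i, h} : Finset ι)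
    rwa [card_pair hih] at this
  have hcard : l ≤ #(A ∪ B)ᶜ := by
    rw [card_compl, card_union_of_disjoint hAB, hA, hB, hn]
    have := Nat.mul_le_mul_right k h2
    omega
  obtain ⟨L, hL, hLc⟩ := exists_subset_card_eq hcard
  rw [subset_compl_comm] at hL
  have hLm : L ∈ powersetCard l (univ : Finset α) := mem_powersetCard.2 ⟨subset_univ _, hLc⟩
  refine ⟨L, hLm, exists_block_eq_and_block_eq (card_compl_of_mem_powersetCard hn hLm) hih ?_ ?_
    hAB⟩
  · exact mem_powersetCard.2 ⟨subset_union_left.trans hL, hA⟩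
  · exact mem_powersetCard.2 ⟨subset_union_right.trans hL, hB⟩

/-- Transposing x and y changes only the cells A and B and keeps L, so the number of hit cells is
unchanged. -/
theorem IsExactHitting.swap (H : IsExactHitting k l N S)
    (hn : Fintype.card α = Fintype.card ι * k + l) {i h : ι} (hih : i ≠ h) {A B : Finset α}
    (hA : #A = k) (hB : #B = k) (hAB : Disjoint A B) {x y : α} (hx : x ∈ A) (hy : y ∈ B) :
    (if A ∈ N i then (1 : ℝ) else 0) + (if B ∈ N h then 1 else 0) =
      (if insert y (A.erase x) ∈ N i then 1 else 0) +
        if insert x (B.erase y) ∈ N h then 1 else 0 := by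
  obtain ⟨L, hL, e, heA, heB⟩ := exists_partition_of_disjoint hn hih hA hB hAB
  have hxL : x ∈ Lᶜ := (mem_powersetCard.1 (block_mem_powersetCard e i)).1 (heA ▸ hx)
  have hyL : y ∈ Lᶜ := (mem_powersetCard.1 (block_mem_powersetCard e h)).1 (heB ▸ hy)
  have hxB : x ∉ B := disjoint_left.1 hAB hx
  have hyA : y ∉ A := disjoint_right.1 hAB hy
  have hxy : x ≠ y := fun h => hyA (h ▸ hx)
  set e' := e.trans (Equiv.swap (⟨x, hxL⟩ : (Lᶜ : Finset α)) ⟨y, hyL⟩) with he'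
  have hmem : ∀ j a, a ∈ block e' j ↔ Equiv.swap x y a ∈ block e j := by
    intro j a
    by_cases ha : a ∈ Lᶜ
    · have := block_trans e (Equiv.swap (⟨x, hxL⟩ : (Lᶜ : Finset α)) ⟨y, hyL⟩) j ⟨a, ha⟩
      rw [← he', Equiv.symm_swap] at this
      rw [this]
      congr! 1
      simp only [Equiv.swap_apply_def, Subtype.mk.injEq]
      split_ifs <;> rfl
    · have hax : a ≠ x := fun h => ha (h ▸ hxL)
      have hay : a ≠ y := fun h => ha (h ▸ hyL)
      rw [Equiv.swap_apply_of_ne_of_ne hax hay]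
      exact iff_of_false
        (fun h => ha ((mem_powersetCard.1 (block_mem_powersetCard _ j)).1 h))
        (fun h => ha ((mem_powersetCard.1 (block_mem_powersetCard _ j)).1 h))
  have hbi : block e' i = insert y (A.erase x) := by
    ext a
    rw [hmem, heA, mem_insert, mem_erase, Equiv.swap_apply_def]
    split_ifs with h1 h2
    · subst h1; simp [hyA, hxy]
    · subst h2; simp [hx]
    · simp [h1, h2]
  have hbh : block e' h = insert x (B.erase y) := by
    ext a
    rw [hmem, heB, mem_insert, mem_erase, Equiv.swap_apply_def]
    split_ifs with h1 h2
    · subst h1; simp [hy]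
    · subst h2; simp [hxB, hxy.symm]
    · simp [h1, h2]
  have hother : ∀ j, j ≠ i → j ≠ h → block e' j = block e j := by
    intro j hji hjh
    have hxj : x ∉ block e j := disjoint_right.1 (disjoint_block e hji) (heA ▸ hx)
    have hyj : y ∉ block e j := disjoint_right.1 (disjoint_block e hjh) (heB ▸ hy)
    ext a
    rw [hmem, Equiv.swap_apply_def]
    split_ifs with h1 h2
    · subst h1; simp [hxj, hyj]
    · subst h2; simp [hxj, hyj]
    · rfl
  have h0 : ∑ j, ((if block e j ∈ N j then (1 : ℝ) else 0) -
      if block e' j ∈ N j then 1 else 0) = 0 := by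
    rw [sum_sub_distrib, H L hL e, H L hL e', sub_self]
  rw [← sum_subset (subset_univ {i, h}), sum_pair hih, heA, heB, hbi, hbh] at h0
  · linarith
  · intro j _ hj
    simp only [mem_insert, mem_singleton, not_or] at hj
    rw [hother j hj.1 hj.2, sub_self]

/-- The effect of replacing x by y depends on neither the set nor the family. For disjoint sets and
distinct indices this is `swap`; in general one compares through a third index m and a set E
disjoint from everything involved. -/
theorem IsExactHitting.exchange_eq (H : IsExactHitting k l N S)
    (hn : Fintype.card α = Fintype.card ι * k + l) (hk : 1 ≤ k) (hι : 3 ≤ Fintype.card ι)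
    {x y : α} (hxy : x ≠ y) (i h : ι) {C D : Finset α} (hC : #C = k - 1) (hD : #D = k - 1)
    (hxC : x ∉ C) (hyC : y ∉ C) (hxD : x ∉ D) (hyD : y ∉ D) :
    ((if insert x C ∈ N i then (1 : ℝ) else 0) - if insert y C ∈ N i then 1 else 0) =
      (if insert x D ∈ N h then 1 else 0) - if insert y D ∈ N h then 1 else 0 := by
  have key : ∀ (i h : ι) (C D : Finset α), i ≠ h → #C = k - 1 → #D = k - 1 → x ∉ C → y ∉ C →
      x ∉ D → y ∉ D → Disjoint C D →
      ((if insert x C ∈ N i then (1 : ℝ) else 0) - if insert y C ∈ N i then 1 else 0) =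
        (if insert x D ∈ N h then 1 else 0) - if insert y D ∈ N h then 1 else 0 := by
    intro i h C D hih hC hD hxC hyC hxD hyD hCD
    have := H.swap hn hih (A := insert x C) (B := insert y D)
      (by rw [card_insert_of_notMem hxC]; omega) (by rw [card_insert_of_notMem hyD]; omega)
      (by simp [hxy.symm, hyC, hxD, hCD]) (mem_insert_self _ _) (mem_insert_self _ _)
    rw [erase_insert hxC, erase_insert hyD] at this
    linarith
  obtain ⟨m, hm⟩ : ∃ m, m ∉ ({i, h} : Finset ι) := by
    by_contra! hall
    have h1 := card_le_two (a := i) (b := h)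
    rw [eq_univ_iff_forall.2 hall, card_univ] at h1
    omega
  simp only [mem_insert, mem_singleton, not_or] at hm
  have hcard : k - 1 ≤ #(C ∪ D ∪ {x, y})ᶜ := by
    rw [card_compl, hn]
    have h1 := card_union_le (C ∪ D) {x, y}
    have h2 := card_union_le C D
    have h3 := card_le_two (a := x) (b := y)
    have := Nat.mul_le_mul_right k hι
    omega
  obtain ⟨E, hE, hEc⟩ := exists_subset_card_eq hcard
  have hEn : ∀ a ∈ C ∪ D ∪ {x, y}, a ∉ E := fun a ha hE' => mem_compl.1 (hE hE') ha
  have hxE := hEn x (by simp)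
  have hyE := hEn y (by simp)
  rw [key i m C E (Ne.symm hm.1) hC hEc hxC hyC hxE hyE
      (disjoint_left.2 fun a ha => hEn a (by simp [ha])),
    key m h E D hm.2 hEc hD hxE hyE hxD hyD
      (disjoint_right.2 fun a ha => hEn a (by simp [ha]))]

/-- The Johnson graph is connected: without such an exchange the indicator of M has zero energy, and
the Poincaré inequality then forces zero variance. -/
theorem exists_exchange_of_ne (hk : 1 ≤ k) {M : Finset (Finset α)} {A B : Finset α}
    (hA : A ∈ powersetCard k univ) (hAM : A ∈ M) (hB : B ∈ powersetCard k univ) (hBM : B ∉ M) :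
    ∃ (x y : α) (C : Finset α), #C = k - 1 ∧ x ∉ C ∧ y ∉ C ∧ insert x C ∈ M ∧ insert y C ∉ M := by
  by_contra! hall
  obtain ⟨j, rfl⟩ : ∃ j, k = j + 1 := ⟨k - 1, by omega⟩
  set f : Finset α → ℝ := fun A => if A ∈ M then 1 else 0 with hf
  have hE : johnsonEnergy univ j f = 0 := by
    refine sum_eq_zero fun C hC => sum_eq_zero fun x hx => sum_eq_zero fun y hy => ?_
    have hC' := (mem_powersetCard.1 hC).2
    have hx' := (mem_sdiff.1 hx).2
    have hy' := (mem_sdiff.1 hy).2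
    have : insert x C ∈ M ↔ insert y C ∈ M :=
      ⟨hall x y C hC' hx' hy', hall y x C hC' hy' hx'⟩
    simp [hf, this]
  have hp := johnson_poincare j univ f
  have hsq : ∀ A, f A ^ 2 = f A := fun A => by simp only [hf]; split_ifs <;> simp
  set a := ∑ A ∈ powersetCard (j + 1) univ, f A with ha
  simp only [hE, mul_zero, hsq, ← ha] at hp
  have hapos : 0 < a := by
    refine sum_pos' (fun A _ => ?_) ⟨A, hA, by simp [hf, hAM]⟩
    simp only [hf]; split_ifs <;> norm_num
  have halt : a < (#(univ : Finset α)).choose (j + 1) := by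
    have h1 : ∑ A ∈ powersetCard (j + 1) (univ : Finset α), (1 : ℝ) =
        (#(univ : Finset α)).choose (j + 1) := by
      rw [sum_const, card_powersetCard, nsmul_eq_mul, mul_one]
    rw [← h1]
    refine sum_lt_sum (fun A _ => ?_) ⟨B, hB, by simp [hf, hBM]⟩
    simp only [hf]; split_ifs <;> norm_num
  have hn : (0 : ℝ) < #(univ : Finset α) := by
    have : 0 < #A := by rw [(mem_powersetCard.1 hA).2]; omega
    exact_mod_cast this.trans_le (card_le_card (subset_univ A))
  have : 0 < 2 * (#(univ : Finset α) : ℝ) * ((#(univ : Finset α)).choose (j + 1) * a - a ^ 2) := by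
    have : 0 < a * ((#(univ : Finset α)).choose (j + 1) - a) := mul_pos hapos (sub_pos.2 halt)
    have := mul_pos hn this
    nlinarith
  linarith

theorem IsExactHitting.exists_star (H : IsExactHitting k l N S)
    (hn : Fintype.card α = Fintype.card ι * k + l) (hk : 1 ≤ k) (hι : 3 ≤ Fintype.card ι)
    (hS : S ⊆ powersetCard l univ) (hSne : S.Nonempty)
    (hN : ∀ i, ∃ A ∈ powersetCard k univ, A ∉ N i) :
    ∃ x, ∀ i, ∀ A ∈ powersetCard k univ, A ∈ N i ↔ x ∈ A := by
  have hn3 : 3 * k ≤ Fintype.card α := by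
    have := Nat.mul_le_mul_right k hι
    omega
  obtain ⟨i₀, A₀, hA₀, hA₀N⟩ : ∃ i, ∃ A ∈ powersetCard k univ, A ∈ N i := by
    obtain ⟨L, hL⟩ := hSne
    obtain ⟨e⟩ : Nonempty (ι × Fin k ≃ (Lᶜ : Finset α)) := by
      rw [← Fintype.card_eq, Fintype.card_prod, Fintype.card_fin, Fintype.card_coe,
        card_compl_of_mem_powersetCard hn (hS hL)]
    have h1 := H L (hS hL) e
    by_contra! hall
    have h2 : ∀ i, block e i ∉ N i := fun i =>
      hall i _ (powersetCard_mono (subset_univ _) (block_mem_powersetCard e i))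
    simp [h2, hL] at h1
  obtain ⟨B₀, hB₀, hB₀N⟩ := hN i₀
  obtain ⟨x, y, C, hC, hxC, hyC, hxCN, hyCN⟩ := exists_exchange_of_ne hk hA₀ hA₀N hB₀ hB₀N
  have hxy : x ≠ y := by rintro rfl; exact hyCN hxCN
  have hexch : ∀ z, z ≠ x → (∃ i D, #D = k - 1 ∧ x ∉ D ∧ z ∉ D ∧ insert x D ∈ N i ∧
      insert z D ∉ N i) → ∀ h E, #E = k - 1 → x ∉ E → z ∉ E →
      insert x E ∈ N h ∧ insert z E ∉ N h := by
    rintro z hz ⟨i, D, hD, hxD, hzD, h1, h2⟩ h E hE hxE hzE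
    have := H.exchange_eq hn hk hι hz.symm i h hD hE hxD hzD hxE hzE
    rw [if_pos h1, if_neg h2] at this
    constructor
    · by_contra h3
      rw [if_neg h3] at this
      split_ifs at this <;> norm_num at this
    · intro h3
      rw [if_pos h3] at this
      split_ifs at this <;> norm_num at this
  have hxyN := hexch y hxy.symm ⟨i₀, C, hC, hxC, hyC, hxCN, hyCN⟩
  have hmem : ∀ h A, #A = k → x ∈ A → y ∉ A → A ∈ N h := by
    intro h A hA hx hy
    have := (hxyN h (A.erase x) (by rw [card_erase_of_mem hx, hA]) (notMem_erase _ _)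
      (fun h => hy (mem_of_mem_erase h))).1
    rwa [insert_erase hx] at this
  -- If A contains y, the exchange excludes it. If A avoids both x and y, then A and a disjoint hit
  -- set containing x would be two hit cells of one partition.
  have hnot : ∀ h A, #A = k → x ∉ A → A ∉ N h := by
    intro h A hA hx hAN
    by_cases hy : y ∈ A
    · have := (hxyN h (A.erase y) (by rw [card_erase_of_mem hy, hA])
        (fun h => hx (mem_of_mem_erase h)) (notMem_erase _ _)).2
      rw [insert_erase hy] at this
      exact this hAN
    · obtain ⟨m, hm⟩ : ∃ m, m ≠ h := by
        have : Nontrivial ι := Fintype.one_lt_card_iff_nontrivial.1 (by omega)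
        exact exists_ne h
      have hcard : k - 1 ≤ #(A ∪ {x, y})ᶜ := by
        rw [card_compl]
        have h1 := card_union_le A {x, y}
        have h3 := card_le_two (a := x) (b := y)
        omega
      obtain ⟨E, hE, hEc⟩ := exists_subset_card_eq hcard
      have hEn : ∀ a ∈ A ∪ {x, y}, a ∉ E := fun a ha hE' => mem_compl.1 (hE hE') ha
      have hxE := hEn x (by simp)
      have hyE := hEn y (by simp)
      have hB : #(insert x E) = k := by rw [card_insert_of_notMem hxE]; omega
      have hBN : insert x E ∈ N m := (hxyN m E hEc hxE hyE).1
      obtain ⟨L, hL, e, he1, he2⟩ := exists_partition_of_disjoint hn hm.symm hA hB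
        (disjoint_left.2 fun a ha ha' => (mem_insert.1 ha').elim (fun h => hx (h ▸ ha))
          (fun h => hEn a (by simp [ha]) h))
      have h1 := H L hL e
      have h2 : ∑ i ∈ {h, m}, (if block e i ∈ N i then (1 : ℝ) else 0) ≤
          ∑ i, (if block e i ∈ N i then (1 : ℝ) else 0) :=
        sum_le_sum_of_subset_of_nonneg (subset_univ _)
          (fun i _ _ => by split_ifs <;> norm_num)
      rw [sum_pair hm.symm, he1, he2, if_pos hAN, if_pos hBN, h1] at h2
      split_ifs at h2 <;> norm_num at h2
  refine ⟨x, fun h A hA => ⟨fun hAN => ?_, fun hx => ?_⟩⟩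
  · by_contra hx
    exact hnot h A (mem_powersetCard.1 hA).2 hx hAN
  · have hAc := (mem_powersetCard.1 hA).2
    by_cases hy : y ∈ A
    -- When A contains both x and y, a point z outside A takes the role of y: the exchange of x for
    -- z is also strict, by `hnot`.
    · obtain ⟨z, hz⟩ : ∃ z, z ∉ A := by
        by_contra! hall
        rw [eq_univ_iff_forall.2 hall, card_univ] at hAc
        omega
      have hzx : z ≠ x := fun h => hz (h ▸ hx)
      have hzy : z ≠ y := fun h => hz (h ▸ hy)
      have hcard : k - 1 ≤ #({x, y, z} : Finset α)ᶜ := by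
        rw [card_compl]
        have h3 := card_le_three (a := x) (b := y) (c := z)
        have h4 : 2 ≤ k := by
          rw [← hAc, ← card_pair hxy]
          exact card_le_card (by simp [insert_subset_iff, hx, hy])
        omega
      obtain ⟨E, hE, hEc⟩ := exists_subset_card_eq hcard
      have hEn : ∀ a ∈ ({x, y, z} : Finset α), a ∉ E := fun a ha hE' => mem_compl.1 (hE hE') ha
      have hxE := hEn x (by simp)
      have hyE := hEn y (by simp)
      have hzE := hEn z (by simp)
      have := (hexch z hzx ⟨h, E, hEc, hxE, hzE, (hxyN h E hEc hxE hyE).1,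
        hnot h _ (by rw [card_insert_of_notMem hzE]; omega) (by simp [hzx.symm, hxE])⟩
        h (A.erase x) (by rw [card_erase_of_mem hx, hAc]) (notMem_erase _ _)
        (fun h => hz (mem_of_mem_erase h))).1
      rwa [insert_erase hx] at this
    · exact hmem h A hAc hx hy

end Stars

/-! ### Density bounds for cross-union families -/

section Cross
open Finset

theorem choose_le_choose_sub_add (n k l : ℕ) (hl : l ≤ n) :
    n.choose (k + 1) ≤ (n - l).choose (k + 1) + l * (n - 1).choose k := by
  induction l with
  | zero => simp
  | succ l ih =>
    obtain ⟨m, hm⟩ : ∃ m, n - l = m + 1 := ⟨n - l - 1, by omega⟩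
    have h1 := ih (by omega)
    have h2 : n - (l + 1) = m := by omega
    have h3 : m.choose k ≤ (n - 1).choose k := Nat.choose_le_choose k (by omega)
    rw [hm, Nat.choose_succ_succ] at h1
    rw [h2, Nat.succ_mul]
    simp only [Nat.succ_eq_add_one] at h1
    omega

/-- Union bound: a random `k`-subset of an `n`-set meets a fixed `l`-set with probability at most
`l * k / n`. -/
theorem sub_mul_choose_le (n k l : ℕ) (hn : 1 ≤ n) (hl : l ≤ n) :
    ((n : ℝ) - l * (k + 1)) * n.choose (k + 1) ≤ n * (n - l).choose (k + 1) := by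
  obtain ⟨m, rfl⟩ : ∃ m, n = m + 1 := ⟨n - 1, by omega⟩
  have h1 : ((m + 1).choose (k + 1) : ℝ) ≤ (m + 1 - l).choose (k + 1) + l * m.choose k := by
    exact_mod_cast choose_le_choose_sub_add (m + 1) k l hl
  have h2 : ((m : ℝ) + 1) * m.choose k = (m + 1).choose (k + 1) * (k + 1) := by
    exact_mod_cast Nat.add_one_mul_choose_eq m k
  have h3 := mul_le_mul_of_nonneg_left h1 (by positivity : (0 : ℝ) ≤ (m : ℝ) + 1)
  push_cast
  nlinarith

theorem choose_mul_choose_sub_comm (n k l : ℕ) :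
    n.choose l * (n - l).choose k = n.choose k * (n - k).choose l := by
  have h1 := Nat.choose_mul (n := n) (Nat.le_add_left l k)
  have h2 := Nat.choose_mul (n := n) (Nat.le_add_right k l)
  rw [Nat.add_sub_cancel] at h1
  rw [Nat.add_sub_cancel_left] at h2
  rw [← h1, ← h2, Nat.choose_symm_add]

variable {n s k l : ℕ} {F : Fin (s + 1) → Finset (Finset (Fin n))}

/-- The `k`-sets missing from the families with index different from `j`. -/
def missing (k : ℕ) (F : Fin (s + 1) → Finset (Finset (Fin n))) (j : Fin (s + 1))
    (i : {i // i ≠ j}) : Finset (Finset (Fin n)) :=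
  powersetCard k univ \ F i

/-- Otherwise P together with the cells would cover the ground set. -/
theorem CrossUnion.exists_block_notMem (hcu : CrossUnion F) (j : Fin (s + 1))
    {P L : Finset (Fin n)} (hP : P ∈ F j) (hL : L ⊆ P)
    (e : {i // i ≠ j} × Fin k ≃ (Lᶜ : Finset (Fin n))) : ∃ i : {i // i ≠ j}, block e i ∉ F i := by
  by_contra! hall
  refine hcu (fun i => if h : i = j then P else block e ⟨i, h⟩) (fun i => ?_) ?_
  · split_ifs with h
    · exact h ▸ hP
    · exact hall ⟨i, h⟩
  · rw [eq_univ_iff_forall]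
    intro a
    rw [mem_biUnion]
    by_cases ha : a ∈ L
    · exact ⟨j, mem_univ _, by simpa using hL ha⟩
    · obtain ⟨i, hi⟩ := exists_mem_block e (mem_compl.2 ha)
      exact ⟨i, mem_univ _, by simpa [i.2] using hi⟩

theorem CrossUnion.one_le_sum_missing (hcu : CrossUnion F) (j : Fin (s + 1))
    {P L : Finset (Fin n)} (hP : P ∈ F j) (hL : L ⊆ P)
    (e : {i // i ≠ j} × Fin k ≃ (Lᶜ : Finset (Fin n))) :
    1 ≤ ∑ i, if block e i ∈ missing k F j i then (1 : ℝ) else 0 := by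
  obtain ⟨i, hi⟩ := hcu.exists_block_notMem j hP hL e
  have hmem : block e i ∈ missing k F j i := mem_sdiff.2
    ⟨powersetCard_mono (subset_univ _) (block_mem_powersetCard e i), hi⟩
  refine le_trans (by rw [if_pos hmem]) (single_le_sum
    (f := fun i => if block e i ∈ missing k F j i then (1 : ℝ) else 0)
    (fun i _ => by split_ifs <;> norm_num) (mem_univ i))

theorem card_subtype_ne (j : Fin (s + 1)) : Fintype.card {i // i ≠ j} = s := by
  rw [Fintype.card_subtype_compl, Fintype.card_fin, Fintype.card_subtype_eq, Nat.add_sub_cancel]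

theorem sum_subtype_ne_eq (j : Fin (s + 1)) (a : Fin (s + 1) → ℝ) :
    ∑ i : {i // i ≠ j}, a i = ∑ i, a i - a j := by
  rw [eq_sub_iff_add_eq, add_comm, Fintype.sum_eq_add_sum_subtype_ne a j]

theorem sum_sum_missing (hk : ∀ j, F j ⊆ powersetCard k univ) (j : Fin (s + 1)) :
    ∑ i : {i // i ≠ j}, ∑ A ∈ powersetCard k univ,
      (if A ∈ missing k F j i then (1 : ℝ) else 0) =
      s * n.choose k - (∑ i, (#(F i) : ℝ) - #(F j)) := by
  have h : ∀ i : {i // i ≠ j}, ∑ A ∈ powersetCard k univ,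
      (if A ∈ missing k F j i then (1 : ℝ) else 0) = n.choose k - #(F i) := by
    intro i
    rw [sum_boole, filter_mem_eq_inter, missing, inter_eq_right.2 sdiff_subset,
      cast_card_sdiff (hk i), card_powersetCard, card_univ, Fintype.card_fin]
  rw [sum_congr rfl fun i _ => h i, sum_sub_distrib, sum_subtype_ne_eq j (fun i => (#(F i) : ℝ)),
    sum_const, card_univ, card_subtype_ne, nsmul_eq_mul]

theorem CrossUnion.eq_of_isExactHitting (hcu : CrossUnion F) (hn : n = s * k + l) (hl : 1 ≤ l)
    (hlk : l ≤ k) (hs : 3 ≤ s) (hk : ∀ j, F j ⊆ powersetCard k univ) (hne : ∀ j, (F j).Nonempty)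
    (hsum : ((s : ℝ) + 1) * (n - 1).choose k ≤ ∑ j, (#(F j) : ℝ)) (j : Fin (s + 1))
    {S : Finset (Finset (Fin n))} (hS : S ⊆ powersetCard l univ) (hSne : S.Nonempty)
    (H : IsExactHitting k l (missing k F j) S) :
    ∃ x, ∀ i, F i = powersetCard k (univ.erase x) := by
  have hcard : Fintype.card (Fin n) = Fintype.card {i // i ≠ j} * k + l := by
    rw [card_subtype_ne, Fintype.card_fin, hn]
  obtain ⟨x, hx⟩ := H.exists_star hcard (hl.trans hlk) (by rwa [card_subtype_ne]) hS hSne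
    (fun i => by
      obtain ⟨A, hA⟩ := hne i
      exact ⟨A, hk i hA, fun h => (mem_sdiff.1 h).2 hA⟩)
  have hmem : ∀ A : Finset (Fin n), A ∈ powersetCard k (univ.erase x) ↔
      A ∈ powersetCard k univ ∧ x ∉ A := by
    intro A
    simp only [mem_powersetCard, subset_erase]
    tauto
  have hother : ∀ i, i ≠ j → F i = powersetCard k (univ.erase x) := by
    intro i hi
    ext A
    rw [hmem]
    constructor
    · intro hA
      exact ⟨hk i hA, fun hxA =>
        (mem_sdiff.1 ((hx ⟨i, hi⟩ A (hk i hA)).2 hxA)).2 hA⟩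
    · rintro ⟨hA, hxA⟩
      by_contra hAF
      exact hxA ((hx ⟨i, hi⟩ A hA).1 (mem_sdiff.2 ⟨hA, hAF⟩))
  have hj : F j ⊆ powersetCard k (univ.erase x) := by
    intro P hP
    rw [hmem]
    refine ⟨hk j hP, fun hxP => ?_⟩
    -- With x placed in L, every cell avoids x and so belongs to its family, contradicting
    -- cross-union.
    obtain ⟨L, hxL, hLP, hLc⟩ := exists_subsuperset_card_eq (singleton_subset_iff.2 hxP)
      (by simpa using hl) (by rwa [(mem_powersetCard.1 (hk j hP)).2])
    obtain ⟨e⟩ : Nonempty ({i // i ≠ j} × Fin k ≃ (Lᶜ : Finset (Fin n))) := by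
      rw [← Fintype.card_eq, Fintype.card_prod, Fintype.card_fin, Fintype.card_coe,
        card_compl_of_mem_powersetCard hcard (mem_powersetCard.2 ⟨subset_univ _, hLc⟩)]
    obtain ⟨i, hi⟩ := hcu.exists_block_notMem j hP hLP e
    rw [hother i i.2, hmem] at hi
    have hb := mem_powersetCard.1 (block_mem_powersetCard e i)
    exact hi ⟨mem_powersetCard.2 ⟨subset_univ _, hb.2⟩,
      fun h => mem_compl.1 (hb.1 h) (hxL (mem_singleton_self x))⟩
  have hcx : #(powersetCard k (univ.erase x)) = (n - 1).choose k := by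
    rw [card_powersetCard, card_erase_of_mem (mem_univ x), card_univ, Fintype.card_fin]
  have hjc : F j = powersetCard k (univ.erase x) := by
    refine eq_of_subset_of_card_le hj ?_
    have h1 := sum_subtype_ne_eq j (fun i => (#(F i) : ℝ))
    rw [sum_congr rfl (g := fun _ => ((n - 1).choose k : ℝ)), sum_const, card_univ,
      card_subtype_ne, nsmul_eq_mul] at h1
    · rw [hcx]
      have : ((n - 1).choose k : ℝ) ≤ #(F j) := by linarith
      exact_mod_cast this
    · intro i _
      rw [hother i i.2, hcx]
  refine ⟨x, fun i => ?_⟩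
  by_cases hi : i = j
  · rw [hi, hjc]
  · exact hother i hi

/-- A density bound for a family of `l`-sets each contained in a member of `F j`, with the
structure of the equality case. -/
theorem CrossUnion.density_le (hcu : CrossUnion F) (hn : n = s * k + l) (hs : 2 ≤ s)
    (hk : ∀ j, F j ⊆ powersetCard k univ) (j : Fin (s + 1)) {S : Finset (Finset (Fin n))}
    (hS : S ⊆ powersetCard l univ) (hSF : ∀ L ∈ S, ∃ A ∈ F j, L ⊆ A) :
    (#S : ℝ) / n.choose l * n.choose k ≤ s * n.choose k - (∑ i, (#(F i) : ℝ) - #(F j)) ∧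
    (s * n.choose k - (∑ i, (#(F i) : ℝ) - #(F j)) ≤ (#S : ℝ) / n.choose l * n.choose k →
      IsExactHitting k l (missing k F j) S) := by
  have hkn : k + l ≤ n := by
    have := Nat.mul_le_mul_right k (show 1 ≤ s by omega)
    omega
  have hcard : Fintype.card (Fin n) = Fintype.card {i // i ≠ j} * k + l := by
    rw [card_subtype_ne, Fintype.card_fin, hn]
  have h := card_mul_choose_le_sum l hcard (by rw [card_subtype_ne]; omega)
    (fun i A => if A ∈ missing k F j i then (1 : ℝ) else 0)
    (fun i A => by split_ifs <;> norm_num) S hS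
    (fun L hL e => by
      obtain ⟨P, hP, hLP⟩ := hSF L hL
      exact hcu.one_le_sum_missing j hP hLP e)
  rw [sum_sum_missing hk, Fintype.card_fin] at h
  have hrel : (n.choose l : ℝ) * (n - l).choose k = n.choose k * (n - k).choose l := by
    exact_mod_cast choose_mul_choose_sub_comm n k l
  have hpos : (0 : ℝ) < (n - k).choose l := by exact_mod_cast Nat.choose_pos (by omega)
  have hlpos : (0 : ℝ) < n.choose l := by exact_mod_cast Nat.choose_pos (by omega)
  have heq : (#S : ℝ) * (n - l).choose k =
      (n - k).choose l * ((#S : ℝ) / n.choose l * n.choose k) := by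
    rw [div_mul_eq_mul_div, mul_div_assoc', eq_div_iff hlpos.ne']
    linear_combination (#S : ℝ) * hrel
  rw [heq] at h
  exact ⟨le_of_mul_le_mul_left h.1 hpos,
    fun hle => h.2 (mul_le_mul_of_nonneg_left hle hpos.le)⟩

/-- Each family has density at least that of a star if the total size is large. -/
theorem CrossUnion.mul_choose_le_card (hcu : CrossUnion F) (hn : n = s * k + l) (hl : 1 ≤ l)
    (hlk : l ≤ k) (hs : 4 * l ≤ s) (hk : ∀ j, F j ⊆ powersetCard k univ)
    (hne : ∀ j, (F j).Nonempty)
    (hsum : ((s : ℝ) + 1) * (n - 1).choose k ≤ ∑ j, (#(F j) : ℝ)) (j : Fin (s + 1)) :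
    (k : ℝ) * n.choose k ≤ n * #(F j) := by
  by_contra! hlt
  obtain ⟨P, hP⟩ := hne j
  obtain ⟨L, hLP, hLc⟩ := exists_subset_card_eq
    (show l ≤ #P by rwa [(mem_powersetCard.1 (hk j hP)).2])
  have hcard : Fintype.card (Fin n) = Fintype.card {i // i ≠ j} * k + l := by
    rw [card_subtype_ne, Fintype.card_fin, hn]
  have hLm := card_compl_of_mem_powersetCard hcard (mem_powersetCard.2 ⟨subset_univ L, hLc⟩)
  have h1 := (choose_mul_le_sum_sum hLm
    (fun i A => if A ∈ missing k F j i then (1 : ℝ) else 0) 1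
    (fun e => hcu.one_le_sum_missing j hP hLP e)).1
  have h2 : ∑ i, ∑ A ∈ powersetCard k Lᶜ, (if A ∈ missing k F j i then (1 : ℝ) else 0) ≤
      ∑ i, ∑ A ∈ powersetCard k univ, (if A ∈ missing k F j i then (1 : ℝ) else 0) :=
    sum_le_sum fun i _ => sum_le_sum_of_subset_of_nonneg (powersetCard_mono (subset_univ _))
      fun A _ _ => by split_ifs <;> norm_num
  rw [sum_sum_missing hk] at h2
  have hsk : k ≤ s * k := Nat.le_mul_of_pos_left k (by omega)
  have hL2 : #Lᶜ = n - l := by rw [card_compl, hLc, Fintype.card_fin]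
  rw [hL2, mul_one] at h1
  obtain ⟨k', rfl⟩ : ∃ k', k = k' + 1 := ⟨k - 1, by omega⟩
  have h3 := sub_mul_choose_le n k' l (by omega) (by omega)
  have h4 := choose_pred_mul n (k' + 1) (by omega) (by omega)
  have hNpos : (0 : ℝ) < n.choose (k' + 1) := by exact_mod_cast Nat.choose_pos (by omega)
  set N : ℝ := (n.choose (k' + 1) : ℝ)
  have hnR : (n : ℝ) = s * (k' + 1) + l := by exact_mod_cast hn
  have hn0 : (0 : ℝ) ≤ n := Nat.cast_nonneg n
  have h5 := mul_le_mul_of_nonneg_left (h1.trans h2) hn0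
  have h6 := mul_le_mul_of_nonneg_left hsum hn0
  push_cast at hlt h4
  -- The left side is n times the union bound for k-sets avoiding L; the right side bounds n times
  -- the number of missing sets. The resulting inequality k(s-l-2) + 2l < 0 is impossible for s ≥
  -- 4l, l ≥ 1.
  have h7 : ((n : ℝ) - l * (k' + 1)) * N < (2 * (k' + 1) - l) * N := by
    have : (n : ℝ) * (s * N) - (s + 1) * ((n - (k' + 1)) * N) + (k' + 1) * N =
        (2 * (k' + 1) - l) * N := by
      rw [hnR]; ring
    nlinarith
  have h8 := lt_of_mul_lt_mul_right h7 hNpos.le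
  have hsR : 4 * (l : ℝ) ≤ s := by exact_mod_cast hs
  have hlR : (1 : ℝ) ≤ l := by exact_mod_cast hl
  have hk0 : (0 : ℝ) ≤ k' := Nat.cast_nonneg k'
  have := mul_le_mul_of_nonneg_right hsR (by positivity : (0 : ℝ) ≤ (k' : ℝ) + 1)
  have := mul_le_mul_of_nonneg_right hlR (by positivity : (0 : ℝ) ≤ (k' : ℝ) + 1)
  nlinarith

theorem CrossUnion.eq_of_le_sum (hcu : CrossUnion F) (hn : n = s * k + l) (hl : 1 ≤ l)
    (hlk : l ≤ k) (hs : 4 * l ≤ s) (hk : ∀ j, F j ⊆ powersetCard k univ)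
    (hne : ∀ j, (F j).Nonempty)
    (hsum : ((s : ℝ) + 1) * (n - 1).choose k ≤ ∑ j, (#(F j) : ℝ)) :
    ∃ x, ∀ i, F i = powersetCard k (univ.erase x) := by
  obtain ⟨j, -, hj⟩ := exists_min_image univ (fun i => #(F i)) univ_nonempty
  have hlow := hcu.mul_choose_le_card hn hl hlk hs hk hne hsum j
  have hsk : 4 * k ≤ s * k := Nat.mul_le_mul_right k (by omega)
  have hstar := choose_pred_mul n k (by omega) (by omega)
  have hNpos : (0 : ℝ) < n.choose k := by exact_mod_cast Nat.choose_pos (by omega)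
  have hnpos : (0 : ℝ) < n := by exact_mod_cast (by omega : 0 < n)
  have hnR : (n : ℝ) = s * k + l := by exact_mod_cast hn
  have hnk : 2 * (k : ℝ) ≤ n := by exact_mod_cast (by omega : 2 * k ≤ n)
  have hspos : (0 : ℝ) < s := by exact_mod_cast (by omega : 0 < s)
  have hk1 : (1 : ℝ) ≤ k := by exact_mod_cast hl.trans hlk
  obtain ⟨d, rfl⟩ : ∃ d, k = l + d := ⟨k - l, by omega⟩
  have hiter := exists_iterated_shadow (α := Fin n) l hl d (by rw [Fintype.card_fin]; omega)
  rw [Fintype.card_fin] at hiter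
  rw [Nat.cast_add] at hstar hlow hnk hnR hk1
  set N : ℝ := (n.choose (l + d) : ℝ) with hN
  rcases le_or_gt ((n : ℝ) * #(F j)) ((n - (l + d)) * N) with hup | hup
  · obtain ⟨S, hS, hSF, hSc⟩ := hiter (F j) (hk j) hlow hup
    have hd := hcu.density_le hn (by omega) hk j hS hSF
    rw [← hN] at hd
    have hSc' := mul_le_mul_of_nonneg_right hSc hNpos.le
    rw [add_mul, div_mul_cancel₀ _ hNpos.ne'] at hSc'
    refine hcu.eq_of_isExactHitting hn hl hlk (by omega) hk hne hsum j hS ?_ (hd.2 ?_)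
    · rw [nonempty_iff_ne_empty]
      rintro rfl
      have h1 : (0 : ℝ) < #(F j) := by exact_mod_cast card_pos.2 (hne j)
      have h2 : (0 : ℝ) ≤ d / n * N := by positivity
      simp only [card_empty, Nat.cast_zero, zero_div, zero_mul] at hSc'
      linarith
    · refine le_trans ?_ hSc'
      -- This is (s+1)(n-k) = sn - d, from n = sk + l and k = l + d. Hence the assumed sum makes
      -- `density_le` tight.
      have h1 : ((s : ℝ) + 1) * (n - 1).choose (l + d) = s * N - d / n * N := by
        have : (((n - 1).choose (l + d) : ℕ) : ℝ) = (n - (l + d)) * N / n := by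
          rw [eq_div_iff hnpos.ne', mul_comm]; exact hstar
        rw [this]
        field_simp
        rw [hnR]; ring
      linarith
  -- Trimming F_j to C(n-1,k) sets gives S density at least (n-l)/n = sk/n. The other s families
  -- then have total density at most s(n-k)/n, although each exceeds (n-k)/n by minimality of F_j.
  · exfalso
    have hcardle : (n - 1).choose (l + d) ≤ #(F j) := by
      have : (n : ℝ) * (n - 1).choose (l + d) ≤ n * #(F j) := by rw [hstar]; exact hup.le
      exact_mod_cast le_of_mul_le_mul_left this hnpos
    obtain ⟨G, hG, hGc⟩ := exists_subset_card_eq hcardle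
    obtain ⟨S, hS, hSG, hSc⟩ := hiter G (hG.trans (hk j))
      (by rw [hGc, hstar]; exact mul_le_mul_of_nonneg_right (by linarith) hNpos.le)
      (by rw [hGc, hstar])
    have hd := (hcu.density_le hn (by omega) hk j hS fun L hL => by
      obtain ⟨A, hA, hLA⟩ := hSG L hL
      exact ⟨A, hG hA, hLA⟩).1
    rw [← hN] at hd
    have hSc' := mul_le_mul_of_nonneg_right hSc hNpos.le
    rw [add_mul, div_mul_cancel₀ _ hNpos.ne', hGc] at hSc'
    have h1 : ((s : ℝ) + 1) * #(F j) ≤ ∑ i, (#(F i) : ℝ) := by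
      have := sum_le_sum fun i (hi : i ∈ (univ : Finset (Fin (s + 1)))) =>
        (Nat.cast_le (α := ℝ)).2 (hj i hi)
      simpa using this
    have h2 := mul_le_mul_of_nonneg_left (hSc'.trans hd) hnpos.le
    have h3 : (n : ℝ) * (d / n * N) = d * N := by field_simp
    have h4 := mul_lt_mul_of_pos_left hup hspos
    have h5 := mul_le_mul_of_nonneg_left h1 hnpos.le
    rw [mul_add, hstar, h3] at h2
    have h6 : (s : ℝ) * (n * N) - s * ((n - (l + d)) * N) = (n - l) * N := by rw [hnR]; ring
    nlinarith

end Cross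

theorem theorem1p2 (n s k l : ℕ) (hn : n = s * k + l) (hl : 1 ≤ l) (hlk : l ≤ k)
    (hs : 4 * l ≤ s) (F : Fin (s + 1) → Finset (Finset (Fin n)))
    (hk : ∀ j, F j ⊆ Finset.powersetCard k Finset.univ)
    (hne : ∀ j, (F j).Nonempty) (hcu : CrossUnion F) :
    (∑ j, ((F j).card : ℝ)) / ((s : ℝ) + 1) ≤ ((n - 1).choose k : ℝ) ∧
    ((∑ j, ((F j).card : ℝ)) / ((s : ℝ) + 1) = ((n - 1).choose k : ℝ) →
      ∃ i : Fin n, ∀ j, F j = Finset.powersetCard k (Finset.univ.erase i)) := by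
  have hs1 : (0 : ℝ) < (s : ℝ) + 1 := by positivity
  have hmain := hcu.eq_of_le_sum hn hl hlk hs hk hne
  constructor
  · rw [div_le_iff₀ hs1, mul_comm]
    -- A sum above the bound already forces the extremal configuration, whose sum equals the bound.
    by_contra! hlt
    obtain ⟨x, hx⟩ := hmain hlt.le
    have hcx : (Finset.powersetCard k (Finset.univ.erase x)).card = (n - 1).choose k := by
      rw [Finset.card_powersetCard, Finset.card_erase_of_mem (Finset.mem_univ x),
        Finset.card_univ, Fintype.card_fin]
    simp [hx, hcx] at hlt
  · intro h
    rw [div_eq_iff hs1.ne'] at h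
    exact hmain (by rw [h, mul_comm])
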